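/- Let $K$ be a field of characteristic $0$, and let $\Lambda$ be the $K$-vector space of symmetric functions, i.e. of power series of bounded degree in variables $x_1,x_2,\dots$ that are invariant under all permutations of the variables. For a partition $\lambda$ of size $|\lambda|$, let $m_\lambda$ be the sum of all distinct monomials whose multiset of nonzero exponents is the multiset of parts of $\lambda$, and let $\widetilde m_\lambda=\big(\prod_{i\ge 1} r_i(\lambda)!\big)\,m_\lambda$, where $r_i(\lambda)$ is the number of parts of $\lambda$ equal to $i$. The $\widetilde m_\lambda$ form a basis of $\Lambda$. Tsujie's ring $\widetilde\Lambda$ is the vector space $\Lambda$ with the bilinear product $\odot$ determined by $\widetilde m_\lambda\odot\widetilde m_\mu=\widetilde m_{\lambda\sqcup\mu}$, where $\lambda\sqcup\mu$ consists of all parts of $\lambda$ together with all parts of $\mu$. A family $(b_\lambda)$ in $\widetilde\Lambda$ indexed by all partitions is a *multiplicative basis* of $\widetilde\Lambda$ if it is a vector space basis and $b_{\lambda\sqcup\mu}=b_\lambda\odot b_\mu$ for all $\lambda,\mu$. A graph here is a finite simple graph $G$ with a positive integer weight $w(v)$ on each vertex $v$. Its total weight is $\sum_v w(v)$, it is a weighted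 clique if every two distinct vertices are adjacent, and $\overline G$ is its complement, with the same weights. Its chromatic symmetric function is $X_G=\sum_\kappa\prod_{v}x_{\kappa(v)}^{w(v)}$, where $\kappa$ ranges over the proper colorings of $G$ by positive integers. The join $G\odot H$ is the disjoint union $G\sqcup H$ together with all edges between $G$ and $H$. **Proposition.** Let $G_1,G_2,\dots$ be a sequence of graphs, and for a partition $\lambda$ with parts $\lambda_1,\dots,\lambda_\ell$ let $G_\lambda=G_{\lambda_1}\sqcup\dots\sqcup G_{\lambda_\ell}$. Then $X_{\overline{G_\lambda}}=X_{\overline{G_{\lambda_1}}\odot\dots\odot\overline{G_{\lambda_\ell}}}$ for every $\lambda$. The family $(X_{\overline{G_\lambda}})_\lambda$ is a multiplicative basis of $\widetilde\Lambda$ if and only if, up to reordering the sequence, each $G_n$ is a weighted clique of total weight $n$; that is, if and only if there is a permutation $\sigma$ of the positive integers such that $G_{\sigma(n)}$ is a weighted clique of total weight $n$ for every $n\ge 1$. Moreover, $(X_{\overline{G_\lambda}})_\lambda$ is a multiplicative basis of $\widetilde\Lambda$ with $X_{\overline{G_\lambda}}$ homogeneous of degree $|\lambda|$ for every $\lambda$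 if and only if $G_n$ is a weighted clique of total weight $n$ for every $n\ge 1$ (with no reordering). -/

import Mathlib

universe u v

namespace Cochromatic

noncomputable section

/-! ## Weighted graphs -/

/-- A weighted graph: a finite vertex set, a simple graph on it, and a positive integer weight on
each vertex. -/
structure WeightedGraph where
  /-- the vertices -/
  V : Type u
  [fintypeV : Fintype V]
  /-- the edges -/
  graph : SimpleGraph V
  /-- the vertex weights -/
  weight : V → ℕ+

attribute [instance] WeightedGraph.fintypeV

namespace WeightedGraph

/-- The sum of all vertex weights. -/
def totalWeight (G : WeightedGraph.{u}) : ℕ := ∑ v, (G.weight v : ℕ)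

/-- A weighted clique: every two distinct vertices are adjacent. -/
def IsClique (G : WeightedGraph.{u}) : Prop :=
  ∀ v w : G.V, v ≠ w → G.graph.Adj v w

/-- The complement, with the same weighted vertices. -/
def compl (G : WeightedGraph.{u}) : WeightedGraph.{u} where
  V := G.V
  graph := G.graphᶜ
  weight := G.weight

/-- The graph without vertices. -/
def empty : WeightedGraph.{u} where
  V := PEmpty.{u + 1}
  graph := ⊥
  weight := PEmpty.elim

/-- The disjoint union: no edges between `G` and `H`. -/
def disjUnion (G H : WeightedGraph.{u}) : WeightedGraph.{u} where
  V := G.V ⊕ H.V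
  graph := G.graph.sum H.graph
  weight := Sum.elim G.weight H.weight

/-- The join: the disjoint union together with all edges between a vertex of `G` and a vertex
of `H`. -/
def join (G H : WeightedGraph.{u}) : WeightedGraph.{u} where
  V := G.V ⊕ H.V
  graph := G.graph.sum H.graph ⊔ completeBipartiteGraph G.V H.V
  weight := Sum.elim G.weight H.weight

/-- The disjoint union of a finite list of graphs. -/
def disjUnionList (L : List WeightedGraph.{u}) : WeightedGraph.{u} := L.foldr disjUnion empty

/-- The join of a finite list of graphs. -/
def joinList (L : List WeightedGraph.{u}) : WeightedGraph.{u} := L.foldr join empty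

end WeightedGraph

/-! ## Partitions -/

/-- Integer partitions (of any size) as multisets of positive integers. The operation `lam ⊔ mu`
that takes all parts of `lam` together with all parts of `mu` is addition of multisets, and the
empty partition is `0`. -/
abbrev IntPartition : Type := Multiset ℕ+

/-- The parts `lam_1 ≥ lam_2 ≥ ⋯ ≥ lam_ℓ` of a partition, as a list. -/
def IntPartition.parts (lam : IntPartition) : List ℕ+ := Multiset.sort lam (fun a b => b ≤ a)

/-- The size `|lam|`, the sum of the parts. -/
def IntPartition.size (lam : IntPartition) : ℕ := (lam.map fun a : ℕ+ => (a : ℕ)).sum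

/-- The number `∏ i, r_i(lam)!`, where `r_i(lam)` is the number of parts equal to `i`. -/
def IntPartition.multFactorial (lam : IntPartition) : ℕ :=
  ∏ i ∈ lam.toFinset, (lam.count i).factorial

/-! ## Symmetric functions -/

section

variable (K : Type v) [Field K]

/-- The space `Λ` of symmetric functions over `K`: power series of bounded degree in variables
`x_1, x_2, …` that are invariant under all permutations of the variables. -/
def SymFun : Submodule K (MvPowerSeries ℕ+ K) where
  carrier := {f | (∃ N : ℕ, ∀ d : ℕ+ →₀ ℕ, MvPowerSeries.coeff d f ≠ 0 → d.degree ≤ N) ∧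
    ∀ (s : Equiv.Perm ℕ+) (d : ℕ+ →₀ ℕ),
      MvPowerSeries.coeff (d.mapDomain s) f = MvPowerSeries.coeff d f}
  zero_mem' := ⟨⟨0, fun d h => absurd (map_zero _) h⟩, fun s d => by simp⟩
  add_mem' := by
    rintro f g ⟨⟨N, hN⟩, hf⟩ ⟨⟨M, hM⟩, hg⟩
    refine ⟨⟨max N M, fun d h => ?_⟩, fun s d => by rw [map_add, map_add, hf, hg]⟩
    by_cases h1 : MvPowerSeries.coeff d f = 0
    · refine le_max_of_le_right (hM d fun h2 => h ?_)
      rw [map_add, h1, h2, add_zero]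
    · exact le_max_of_le_left (hN d h1)
  smul_mem' := by
    rintro c f ⟨⟨N, hN⟩, hf⟩
    refine ⟨⟨N, fun d h => hN d fun h1 => h ?_⟩, fun s d => by rw [map_smul, map_smul, hf]⟩
    rw [map_smul, h1, smul_zero]

end

variable {K : Type v} [Field K]

/-- The exponent vector `d` has shape `lam` if its nonzero exponents, with multiplicity, are the
parts of `lam`. -/
def HasShape (d : ℕ+ →₀ ℕ) (lam : IntPartition) : Prop :=
  d.support.val.map d = lam.map fun a : ℕ+ => (a : ℕ)

theorem HasShape.mapDomain {d : ℕ+ →₀ ℕ} {lam : IntPartition} (s : Equiv.Perm ℕ+) :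
    HasShape (d.mapDomain s) lam ↔ HasShape d lam := by
  have h : (d.mapDomain s).support.val.map (d.mapDomain s) = d.support.val.map d := by
    have : d.mapDomain s = d.embDomain s.toEmbedding := by
      rw [Finsupp.embDomain_eq_mapDomain]; rfl
    rw [this, Finsupp.support_embDomain, Finset.map_val, Multiset.map_map]
    refine Multiset.map_congr rfl fun x _ => ?_
    exact Finsupp.embDomain_apply_self _ _ _
  rw [HasShape, HasShape, h]

theorem HasShape.degree_eq {d : ℕ+ →₀ ℕ} {lam : IntPartition} (h : HasShape d lam) :
    d.degree = lam.size := by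
  rw [IntPartition.size, ← show _ = _ from h]; rfl

open Classical in
/-- The monomial symmetric function `m_lam`: the sum of all distinct monomials whose exponents are
the parts of `lam`. -/
def monomialSym (K : Type v) [Field K] (lam : IntPartition) : SymFun K :=
  ⟨fun d => if HasShape d lam then 1 else 0, by
    refine ⟨⟨lam.size, fun d h => ?_⟩, fun s d => ?_⟩
    · by_contra h2
      refine h (if_neg fun h3 => h2 h3.degree_eq.le)
    · exact if_congr (HasShape.mapDomain s) rfl rfl⟩

/-- The augmented monomial symmetric function `m̃_lam = (∏ i, r_i(lam)!) m_lam`. -/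
def augMonomial (K : Type v) [Field K] (lam : IntPartition) : SymFun K :=
  (lam.multFactorial : K) • monomialSym K lam

/-! ### The augmented monomial symmetric functions form a basis -/

theorem HasShape.unique {d : ℕ+ →₀ ℕ} {lam mu : IntPartition} (h : HasShape d lam)
    (h' : HasShape d mu) : lam = mu :=
  Multiset.map_injective PNat.coe_injective (h.symm.trans h')

theorem HasShape.exists_vec (lam : IntPartition) : ∃ d, HasShape d lam := by
  induction lam using Multiset.induction_on with
  | empty => exact ⟨0, by simp [HasShape]⟩
  | cons a s ih =>
    obtain ⟨d, hd⟩ := ih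
    obtain ⟨i, hi⟩ := Infinite.exists_notMem_finset d.support
    refine ⟨d + Finsupp.single i (a : ℕ), ?_⟩
    have hdis : Disjoint d.support (Finsupp.single i (a : ℕ)).support := by
      rw [Finsupp.support_single i a.ne_zero]
      exact Finset.disjoint_singleton_right.2 hi
    have hdi : d i = 0 := Finsupp.notMem_support_iff.1 hi
    have hsup : (d + Finsupp.single i (a : ℕ)).support = Finset.cons i d.support hi := by
      rw [Finsupp.support_add_eq hdis, Finsupp.support_single i a.ne_zero]
      ext; simp
    rw [HasShape, hsup, Finset.cons_val, Multiset.map_cons, Multiset.map_cons,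
      ← show _ = _ from hd]
    congr 1
    · simp [hdi]
    · refine Multiset.map_congr rfl fun x hx => ?_
      have : x ≠ i := fun h => hi (h ▸ hx)
      simp [this.symm]

theorem HasShape.exists_shape (d : ℕ+ →₀ ℕ) : ∃ lam, HasShape d lam := by
  refine ⟨(d.support.val.map d).map Nat.toPNat', ?_⟩
  rw [HasShape, Multiset.map_map, Multiset.map_map]
  refine Multiset.map_congr rfl fun x hx => ?_
  have : d x ≠ 0 := Finsupp.mem_support_iff.1 hx
  simp [Function.comp, Nat.toPNat'_coe, Nat.pos_of_ne_zero this]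

theorem HasShape.exists_perm {d d' : ℕ+ →₀ ℕ} {lam : IntPartition} (h : HasShape d lam)
    (h' : HasShape d' lam) : ∃ s : Equiv.Perm ℕ+, d.mapDomain s = d' := by
  have key : ∀ k : ℕ, Nonempty ({i // d i = k} ≃ {i // d' i = k}) := by
    intro k
    rcases Nat.eq_zero_or_pos k with rfl | hk
    · have inf : ∀ e : ℕ+ →₀ ℕ, Infinite {i // e i = 0} := fun e => by
        have : {i | e i = 0} = ((e.support : Set ℕ+))ᶜ := by ext; simp
        have h2 : {i | e i = 0}.Infinite := by
          rw [this]; exact e.support.finite_toSet.infinite_compl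
        exact h2.to_subtype
      have := inf d
      have := inf d'
      exact nonempty_equiv_of_countable
    · have cnt : ∀ e : ℕ+ →₀ ℕ, HasShape e lam →
          ∃ _ : Fintype {i // e i = k}, Fintype.card {i // e i = k} =
            (lam.map fun a : ℕ+ => (a : ℕ)).count k := fun e he => by
        have hm : ∀ x, x ∈ e.support.filter (fun i => e i = k) ↔ e x = k := fun x => by
          simp; omega
        refine ⟨Fintype.subtype _ hm, ?_⟩
        rw [Fintype.subtype_card _ hm, ← show _ = _ from he, Multiset.count_map,
          Finset.card_def, Finset.filter_val]
        congr 1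
        exact Multiset.filter_congr fun x _ => eq_comm
      obtain ⟨i1, h1⟩ := cnt d h
      obtain ⟨i2, h2⟩ := cnt d' h'
      exact ⟨Fintype.equivOfCardEq (h1.trans h2.symm)⟩
  let e := fun k => (key k).some
  let s : Equiv.Perm ℕ+ := (Equiv.sigmaFiberEquiv d).symm.trans
    ((Equiv.sigmaCongrRight e).trans (Equiv.sigmaFiberEquiv d'))
  have hs : ∀ i, d' (s i) = d i := fun i => (e (d i) ⟨i, rfl⟩).2
  refine ⟨s, Finsupp.ext fun j => ?_⟩
  obtain ⟨i, rfl⟩ := s.surjective j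
  rw [Finsupp.mapDomain_apply s.injective, hs]

theorem coeff_monomialSym {d : ℕ+ →₀ ℕ} {lam : IntPartition} (mu : IntPartition)
    (h : HasShape d lam) :
    MvPowerSeries.coeff d (monomialSym K mu : MvPowerSeries ℕ+ K) = if mu = lam then 1 else 0 := by
  classical
  rw [MvPowerSeries.coeff_apply]
  exact if_congr ⟨fun h' => h'.unique h, fun e => e ▸ h⟩ rfl rfl

theorem coeff_sum_monomialSym {d : ℕ+ →₀ ℕ} {lam : IntPartition} (c : IntPartition →₀ K)
    (h : HasShape d lam) :
    MvPowerSeries.coeff d (Finsupp.linearCombination K (monomialSym K) c : MvPowerSeries ℕ+ K)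
      = c lam := by
  classical
  rw [Finsupp.linearCombination_apply, Finsupp.sum, Submodule.coe_sum, map_sum]
  simp only [Submodule.coe_smul, map_smul, coeff_monomialSym _ h, smul_eq_mul, mul_ite, mul_one,
    mul_zero]
  rw [Finset.sum_ite_eq' c.support lam (fun x => c x)]
  simp +contextual [eq_comm]

theorem finite_size_le (N : ℕ) : {lam : IntPartition | lam.size ≤ N}.Finite := by
  classical
  let B : Multiset ℕ+ := (N + 1) • (Finset.Icc 1 (N.succPNat)).val
  refine (Set.finite_Iic B).subset fun lam (h : IntPartition.size lam ≤ N) => ?_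
  have hel : ∀ a ∈ lam, (a : ℕ) ≤ N := fun a ha =>
    (Multiset.single_le_sum (fun _ _ => Nat.zero_le _) _ (Multiset.mem_map_of_mem _ ha)).trans h
  have hcard : Multiset.card lam ≤ N := by
    refine le_trans ?_ h
    have := Multiset.card_nsmul_le_sum (s := lam.map fun a : ℕ+ => (a : ℕ)) (a := 1) (by
      intro x hx
      obtain ⟨a, -, rfl⟩ := Multiset.mem_map.1 hx
      exact a.pos)
    simpa [IntPartition.size] using this
  refine Multiset.le_iff_count.2 fun a => ?_
  by_cases ha : a ∈ lam
  · have hmem : a ∈ Finset.Icc 1 (N.succPNat) := by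
      rw [Finset.mem_Icc]
      refine ⟨one_le, ?_⟩
      rw [← PNat.coe_le_coe, Nat.succPNat_coe]
      exact (hel a ha).trans (Nat.le_succ N)
    rw [Multiset.count_nsmul, Multiset.count_eq_one_of_mem (Finset.nodup _) hmem]
    have := Multiset.count_le_card a lam
    omega
  · rw [Multiset.count_eq_zero_of_notMem ha]; exact Nat.zero_le _

/-- The basis of monomial symmetric functions. -/
def monomialBasis (K : Type v) [Field K] : Module.Basis IntPartition K (SymFun K) := by
  refine Module.Basis.mk (v := monomialSym K) ?_ ?_
  · rw [linearIndependent_iff]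
    intro c hc
    ext lam
    obtain ⟨d, hd⟩ := HasShape.exists_vec lam
    rw [← coeff_sum_monomialSym c hd, hc]
    simp
  · rintro ⟨f, ⟨N, hN⟩, hf⟩ -
    choose d hd using HasShape.exists_vec
    have hfin : (Function.support fun lam => MvPowerSeries.coeff (d lam) f).Finite := by
      refine (finite_size_le N).subset fun lam h => ?_
      rw [Set.mem_ofPred_eq, ← (hd lam).degree_eq]
      exact hN _ h
    rw [Finsupp.mem_span_range_iff_exists_finsupp]
    refine ⟨Finsupp.ofSupportFinite _ hfin, ?_⟩
    rw [← Finsupp.linearCombination_apply]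
    refine Subtype.ext (MvPowerSeries.ext fun d' => ?_)
    obtain ⟨lam, h⟩ := HasShape.exists_shape d'
    rw [coeff_sum_monomialSym _ h]
    obtain ⟨s, rfl⟩ := (hd lam).exists_perm h
    rw [hf]; rfl

/-! ## Chromatic symmetric functions -/

/-- The exponent vector of the monomial `∏ v, x_(c v) ^ w(v)` of a coloring `c`. -/
def WeightedGraph.exponent (G : WeightedGraph.{u}) (c : G.V → ℕ+) : ℕ+ →₀ ℕ :=
  ∑ v, Finsupp.single (c v) (G.weight v : ℕ)

theorem WeightedGraph.degree_exponent (G : WeightedGraph.{u}) (c : G.V → ℕ+) :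
    (G.exponent c).degree = G.totalWeight := by
  simp [WeightedGraph.exponent, WeightedGraph.totalWeight, Finsupp.degree_single]

theorem WeightedGraph.mapDomain_exponent (G : WeightedGraph.{u}) (c : G.V → ℕ+)
    (s : Equiv.Perm ℕ+) : (G.exponent c).mapDomain s = G.exponent (s ∘ c) := by
  simp [WeightedGraph.exponent, Finsupp.mapDomain_finsetSum, Finsupp.mapDomain_single]

/-- Only finitely many colorings, proper or not, contribute to a given monomial. So the number
of proper colorings in the next definition is a count of a finite set. -/
theorem WeightedGraph.finite_exponent_eq (G : WeightedGraph.{u}) (d : ℕ+ →₀ ℕ) :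
    {c : G.graph.Coloring ℕ+ | G.exponent c = d}.Finite := by
  have h : (Set.univ.pi fun _ : G.V => (d.support : Set ℕ+)).Finite :=
    Set.Finite.pi fun _ => d.support.finite_toSet
  refine Set.Finite.of_finite_image (f := fun c : G.graph.Coloring ℕ+ => (c : G.V → ℕ+))
    (h.subset ?_) (DFunLike.coe_injective.injOn)
  rintro _ ⟨c, hc, rfl⟩ v -
  have hc : G.exponent c = d := hc
  rw [Finset.mem_coe, Finsupp.mem_support_iff, ← hc, WeightedGraph.exponent,
    Finsupp.finsetSum_apply]
  intro h0
  have := Finset.sum_eq_zero_iff.1 h0 v (Finset.mem_univ v)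
  simp at this

/-- The chromatic symmetric function `X_G = ∑ c, ∏ v, x_(c v) ^ w(v)` as a power series, where `c`
ranges over all proper colorings of `G` with positive integers: the coefficient at an exponent
vector `d` is the number of proper colorings whose monomial has exponent vector `d`. -/
def WeightedGraph.csfSeries (K : Type v) [Field K] (G : WeightedGraph.{u}) : MvPowerSeries ℕ+ K :=
  fun d => (Nat.card {c : G.graph.Coloring ℕ+ // G.exponent c = d} : K)

theorem WeightedGraph.coeff_csfSeries (G : WeightedGraph.{u}) (d : ℕ+ →₀ ℕ) :
    MvPowerSeries.coeff d (G.csfSeries K) =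
      (Nat.card {c : G.graph.Coloring ℕ+ // G.exponent c = d} : K) := rfl

/-- The chromatic symmetric function as an element of `Λ`. -/
def WeightedGraph.csf (K : Type v) [Field K] (G : WeightedGraph.{u}) : SymFun K :=
  ⟨G.csfSeries K, by
    refine ⟨⟨G.totalWeight, fun d h => ?_⟩, fun s d => ?_⟩
    · by_contra hd
      refine h ?_
      have : IsEmpty {c : G.graph.Coloring ℕ+ // G.exponent c = d} :=
        ⟨fun c => hd (by rw [← c.2, G.degree_exponent])⟩
      rw [G.coeff_csfSeries, Nat.card_of_isEmpty, Nat.cast_zero]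
    · rw [G.coeff_csfSeries, G.coeff_csfSeries]
      refine congrArg Nat.cast (Nat.card_congr ?_)
      refine Equiv.subtypeEquiv ⟨fun c => (SimpleGraph.Embedding.completeGraph
          s.symm.toEmbedding).toHom.comp c, fun c => (SimpleGraph.Embedding.completeGraph
          s.toEmbedding).toHom.comp c, fun c => ?_, fun c => ?_⟩ fun c => ?_
      · ext v; simp
      · ext v; simp
      · rw [← (Finsupp.mapDomain_injective s.symm.injective).eq_iff, G.mapDomain_exponent,
          ← Finsupp.mapDomain_comp]
        simp [Finsupp.mapDomain_id]⟩

section Tsujie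

variable [CharZero K]

/-- The basis of augmented monomial symmetric functions. -/
def augBasis (K : Type v) [Field K] [CharZero K] : Module.Basis IntPartition K (SymFun K) :=
  (monomialBasis K).unitsSMul fun lam => Units.mk0 (lam.multFactorial : K) (by
    rw [Nat.cast_ne_zero]
    exact Finset.prod_ne_zero_iff.2 fun i _ => Nat.factorial_ne_zero _)

theorem augBasis_apply (lam : IntPartition) : augBasis K lam = augMonomial K lam := by
  rw [augBasis, Module.Basis.unitsSMul_apply, monomialBasis, Module.Basis.mk_apply]
  rfl

/-! ## Tsujie's ring -/

/-- The bilinear product `⊙` on symmetric functions with `m̃_lam ⊙ m̃_mu = m̃_(lam ⊔ mu)`. -/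
def odot (K : Type v) [Field K] [CharZero K] : SymFun K →ₗ[K] SymFun K →ₗ[K] SymFun K :=
  (augBasis K).constr K fun lam => (augBasis K).constr K fun mu => augMonomial K (lam + mu)

theorem odot_augMonomial (lam mu : IntPartition) :
    odot K (augMonomial K lam) (augMonomial K mu) = augMonomial K (lam + mu) := by
  rw [← augBasis_apply, ← augBasis_apply, odot, Module.Basis.constr_basis,
    Module.Basis.constr_basis]

theorem augMonomial_induction {P : SymFun K → Prop} (hm : ∀ lam, P (augMonomial K lam))
    (h0 : P 0) (hadd : ∀ f g, P f → P g → P (f + g)) (hsmul : ∀ (c : K) f, P f → P (c • f))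
    (f : SymFun K) : P f := by
  refine Submodule.span_induction (p := fun f _ => P f) ?_ h0 (fun f g _ _ => hadd f g)
    (fun c f _ => hsmul c f) ((augBasis K).mem_span f)
  rintro _ ⟨lam, rfl⟩
  rw [augBasis_apply]; exact hm lam

theorem odot_comm (f g : SymFun K) : odot K f g = odot K g f := by
  induction f using augMonomial_induction with
  | hm lam =>
    induction g using augMonomial_induction with
    | hm mu => rw [odot_augMonomial, odot_augMonomial, add_comm]
    | h0 => simp
    | hadd f g hf hg => simp [hf, hg]
    | hsmul c f hf => simp [hf]
  | h0 => simp
  | hadd f g hf hg => simp [hf, hg]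
  | hsmul c f hf => simp [hf]

theorem odot_assoc (f g h : SymFun K) : odot K (odot K f g) h = odot K f (odot K g h) := by
  induction f using augMonomial_induction with
  | hm lam =>
    induction g using augMonomial_induction with
    | hm mu =>
      induction h using augMonomial_induction with
      | hm nu => simp only [odot_augMonomial, add_assoc]
      | h0 => simp
      | hadd f g hf hg => simp [hf, hg]
      | hsmul c f hf => simp [hf]
    | h0 => simp
    | hadd f g hf hg => simp [hf, hg]
    | hsmul c f hf => simp [hf]
  | h0 => simp
  | hadd f g hf hg => simp [hf, hg]
  | hsmul c f hf => simp [hf]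

theorem one_odot (f : SymFun K) : odot K (augMonomial K 0) f = f := by
  induction f using augMonomial_induction with
  | hm lam => rw [odot_augMonomial, zero_add]
  | h0 => simp
  | hadd f g hf hg => simp [hf, hg]
  | hsmul c f hf => simp [hf]

/-- Tsujie's ring `Λ̃`: the vector space `Λ` of symmetric functions with the product `⊙`. -/
def TsujieRing (K : Type v) [Field K] [CharZero K] : Type v := SymFun K

instance instAddCommGroupTsujieRing : AddCommGroup (TsujieRing K) :=
  inferInstanceAs (AddCommGroup (SymFun K))

instance instModuleTsujieRing : Module K (TsujieRing K) :=
  inferInstanceAs (Module K (SymFun K))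

/-- The identity map from `Λ` to `Λ̃`. -/
def toTsujie : SymFun K ≃ₗ[K] TsujieRing K := LinearEquiv.refl K (SymFun K)

instance instCommRingTsujieRing : CommRing (TsujieRing K) :=
  { instAddCommGroupTsujieRing with
    mul := fun f g => toTsujie (odot K (toTsujie.symm f) (toTsujie.symm g))
    one := toTsujie (augMonomial K 0)
    mul_assoc := fun f g h => odot_assoc (K := K) f g h
    mul_comm := fun f g => odot_comm (K := K) f g
    one_mul := fun f => one_odot (K := K) f
    mul_one := fun f => (odot_comm (K := K) f _).trans (one_odot (K := K) f)
    left_distrib := fun f g h => map_add (odot K (toTsujie.symm f)) _ _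
    right_distrib := fun _ _ _ => LinearMap.map_add₂ (odot K) _ _ _
    zero_mul := fun _ => LinearMap.map_zero₂ (odot K) _
    mul_zero := fun f => map_zero (odot K (toTsujie.symm f)) }

instance instAlgebraTsujieRing : Algebra K (TsujieRing K) :=
  Algebra.ofModule (fun c _ _ => LinearMap.map_smul₂ (odot K) c _ _)
    (fun c f _ => map_smul (odot K (toTsujie.symm f)) c _)

theorem toTsujie_augMonomial_mul (lam mu : IntPartition) :
    toTsujie (augMonomial K lam) * toTsujie (augMonomial K mu) =
      toTsujie (augMonomial K (lam + mu)) :=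
  congrArg toTsujie (odot_augMonomial lam mu)

/-- A family `b` in `Λ̃`, indexed by all partitions, is a multiplicative basis if it is a vector
space basis and `b_(lam ⊔ mu) = b_lam ⊙ b_mu` for all `lam` and `mu`. -/
structure IsMultiplicativeBasis (b : IntPartition → TsujieRing K) : Prop where
  linearIndependent : LinearIndependent K b
  span_eq_top : Submodule.span K (Set.range b) = ⊤
  map_add : ∀ lam mu : IntPartition, b (lam + mu) = b lam * b mu

/-- The family `b` is graded if `b_lam` is homogeneous of degree `|lam|` for every `lam`. -/
def IsGradedFamily (b : IntPartition → TsujieRing K) : Prop :=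
  ∀ lam : IntPartition,
    MvPowerSeries.IsHomogeneous (toTsujie.symm (b lam) : MvPowerSeries ℕ+ K) lam.size

/-! ## The families attached to a sequence of graphs -/

/-- The graph `G_lam`, the disjoint union of `G_(lam_1), …, G_(lam_ℓ)`. -/
def unionAlong (G : ℕ+ → WeightedGraph.{u}) (lam : IntPartition) : WeightedGraph.{u} :=
  WeightedGraph.disjUnionList (lam.parts.map G)

/-- The join of the complements of `G_(lam_1), …, G_(lam_ℓ)`. -/
def joinComplAlong (G : ℕ+ → WeightedGraph.{u}) (lam : IntPartition) : WeightedGraph.{u} :=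
  WeightedGraph.joinList (lam.parts.map fun n => (G n).compl)

/-- The family of the chromatic symmetric functions of the complements of the `G_lam`, as elements
of `Λ̃`. -/
def cochromaticFamily (K : Type v) [Field K] [CharZero K] (G : ℕ+ → WeightedGraph.{u}) :
    IntPartition → TsujieRing K :=
  fun lam => toTsujie ((unionAlong G lam).compl.csf K)

end Tsujie

end

end Cochromatic

/-! A proper coloring of a weighted clique is injective, so its chromatic symmetric function is an
augmented monomial function (`WeightedGraph.csf_of_isClique`). The join of two cliques is a clique
with both collections of weights. A coloring of any join is a pair of colorings with disjoint color
sets, which gives a bilinear coefficient formula; evaluated on cliques it identifies `⊙`, so `X`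
turns every join into a product (`coeff_odot`, `WeightedGraph.csf_join`). Complementation turns
disjoint unions into joins. Hence the family is multiplicative for every sequence of graphs, and the
only question is when it is a vector space basis.

Under `⊙` the ring is polynomial in the `m̃_(k)`, and the linear part of a generator decides the
matter. The coefficient of `m̃_(k)` in the function of the complement of `G` is that of `x_1^k`; it
counts colorings by one color, so it is `1` if `G` is a clique of weight `k` and `0` otherwise.

If each `G_n` is a clique of weight `n`, the family is `m̃_lam` plus terms of the same size with
more parts, a unitriangular change of basis (`cochromaticFamily_sub_mem_partSpan`). Conversely, if
no `G_n` is a clique of weight `k`, the coordinate at `{k}` vanishes on the whole family, so the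
family cannot span. Choosing a clique of each weight gives a subfamily that already spans, and
linear independence leaves no room for other graphs. A grading fixes the order, since it prescribes
the weight of each clique. -/

namespace Cochromatic

variable {K : Type v} [Field K]

/-! ### Exponent vectors and colorings of joins and cliques -/

namespace WeightedGraph

theorem exponent_apply_pos (G : WeightedGraph.{u}) (c : G.V → ℕ+) (v : G.V) :
    G.exponent c (c v) ≠ 0 := by
  rw [exponent, Finsupp.finsetSum_apply]
  intro h
  simpa using Finset.sum_eq_zero_iff.1 h v (Finset.mem_univ v)

theorem mem_support_exponent (G : WeightedGraph.{u}) (c : G.V → ℕ+) (i : ℕ+) :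
    i ∈ (G.exponent c).support ↔ ∃ v, c v = i := by
  refine ⟨fun h => ?_, ?_⟩
  · by_contra! hne
    refine Finsupp.mem_support_iff.1 h ?_
    rw [exponent, Finsupp.finsetSum_apply]
    exact Finset.sum_eq_zero fun v _ => Finsupp.single_eq_of_ne (hne v).symm
  · rintro ⟨v, rfl⟩
    exact Finsupp.mem_support_iff.2 (G.exponent_apply_pos c v)

theorem exponent_apply_of_injective (G : WeightedGraph.{u}) {c : G.V → ℕ+}
    (hc : Function.Injective c) (v : G.V) : G.exponent c (c v) = G.weight v := by
  rw [exponent, Finsupp.finsetSum_apply, Finset.sum_eq_single v]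
  · simp
  · exact fun w _ hw => Finsupp.single_eq_of_ne (hc.ne hw).symm
  · simp

/-- The exponent vector of an injective coloring has the vertex weights as its nonzero entries. -/
theorem hasShape_exponent (G : WeightedGraph.{u}) {c : G.V → ℕ+} (hc : Function.Injective c) :
    HasShape (G.exponent c) (Finset.univ.val.map G.weight) := by
  have hs : (G.exponent c).support = Finset.univ.map ⟨c, hc⟩ := by
    ext i
    simp only [mem_support_exponent, Finset.mem_map, Finset.mem_univ, true_and,
      Function.Embedding.coeFn_mk]
  rw [HasShape, hs, Finset.map_val, Multiset.map_map, Multiset.map_map]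
  exact Multiset.map_congr rfl fun v _ => G.exponent_apply_of_injective hc v

theorem exponent_join (G H : WeightedGraph.{u}) (c : G.V ⊕ H.V → ℕ+) :
    (G.join H).exponent c = G.exponent (c ∘ Sum.inl) + H.exponent (c ∘ Sum.inr) :=
  Fintype.sum_sum_type _

/-- A proper coloring of a join is a pair of proper colorings that share no color. -/
noncomputable def joinColoringEquiv (G H : WeightedGraph.{u}) (d : ℕ+ →₀ ℕ) :
    {c : (G.join H).graph.Coloring ℕ+ // (G.join H).exponent c = d} ≃
      Σ p : {p // p ∈ (Finset.HasAntidiagonal.antidiagonal d).filter fun p => Disjoint p.1.support p.2.support},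
        {a : G.graph.Coloring ℕ+ // G.exponent a = p.1.1} ×
          {b : H.graph.Coloring ℕ+ // H.exponent b = p.1.2} where
  toFun c :=
    ⟨⟨(G.exponent (c.1 ∘ Sum.inl), H.exponent (c.1 ∘ Sum.inr)), by
      rw [Finset.mem_filter, Finset.HasAntidiagonal.mem_antidiagonal]
      refine ⟨(exponent_join G H c.1).symm.trans c.2, Finset.disjoint_left.2 fun i hi hj => ?_⟩
      obtain ⟨v, hv⟩ := (G.mem_support_exponent _ i).1 hi
      obtain ⟨w, hw⟩ := (H.mem_support_exponent _ i).1 hj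
      refine c.1.valid (v := Sum.inl v) (w := Sum.inr w) ?_ (hv.trans hw.symm)
      exact Or.inr (Or.inl ⟨rfl, rfl⟩)⟩,
      ⟨SimpleGraph.Coloring.mk (c.1 ∘ Sum.inl) fun {v w} h =>
        c.1.valid (v := Sum.inl v) (w := Sum.inl w) (Or.inl h), rfl⟩,
      ⟨SimpleGraph.Coloring.mk (c.1 ∘ Sum.inr) fun {v w} h =>
        c.1.valid (v := Sum.inr v) (w := Sum.inr w) (Or.inl h), rfl⟩⟩
  invFun q :=
    ⟨SimpleGraph.Coloring.mk (Sum.elim q.2.1.1 q.2.2.1) (by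
      obtain ⟨⟨p, hp⟩, ⟨a, ha⟩, ⟨b, hb⟩⟩ := q
      have hdis := Finset.disjoint_left.1 (Finset.mem_filter.1 hp).2
      have hne : ∀ v w, a v ≠ b w := fun v w h =>
        hdis (by rw [← ha]; exact (G.mem_support_exponent _ _).2 ⟨v, rfl⟩)
          (by rw [← hb]; exact (H.mem_support_exponent _ _).2 ⟨w, h.symm⟩)
      rintro (v | v) (w | w) h
      · exact a.valid (by simpa [join] using h)
      · exact hne v w
      · exact (hne w v).symm
      · exact b.valid (by simpa [join] using h)), by
      obtain ⟨⟨p, hp⟩, ⟨a, ha⟩, ⟨b, hb⟩⟩ := q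
      refine (exponent_join G H _).trans ?_
      exact (congrArg₂ (· + ·) ha hb).trans
        (Finset.HasAntidiagonal.mem_antidiagonal.1 (Finset.mem_filter.1 hp).1)⟩
  left_inv c := by
    refine Subtype.ext (DFunLike.ext _ _ ?_)
    rintro (v | v) <;> rfl
  right_inv q := by
    obtain ⟨⟨⟨p1, p2⟩, hp⟩, ⟨a, ha⟩, ⟨b, hb⟩⟩ := q
    dsimp only at ha hb
    subst ha hb
    rfl

/-- Counts both sides of `joinColoringEquiv`; the fibers are finite, so cardinalities add and
multiply. -/
theorem coeff_csf_join (G H : WeightedGraph.{u}) (d : ℕ+ →₀ ℕ) :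
    MvPowerSeries.coeff d ((G.join H).csf K : MvPowerSeries ℕ+ K) =
      ∑ p ∈ (Finset.HasAntidiagonal.antidiagonal d).filter fun p => Disjoint p.1.support p.2.support,
        MvPowerSeries.coeff p.1 (G.csf K : MvPowerSeries ℕ+ K) *
          MvPowerSeries.coeff p.2 (H.csf K : MvPowerSeries ℕ+ K) := by
  have (e : ℕ+ →₀ ℕ) : Finite {a : G.graph.Coloring ℕ+ // G.exponent a = e} :=
    (G.finite_exponent_eq e).to_subtype
  have (e : ℕ+ →₀ ℕ) : Finite {a : H.graph.Coloring ℕ+ // H.exponent a = e} :=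
    (H.finite_exponent_eq e).to_subtype
  refine (coeff_csfSeries _ d).trans ?_
  rw [Nat.card_congr (joinColoringEquiv G H d), Nat.card_sigma, Nat.cast_sum]
  rw [← Finset.sum_coe_sort ((Finset.HasAntidiagonal.antidiagonal d).filter
    fun p => Disjoint p.1.support p.2.support)]
  refine Finset.sum_congr rfl fun p _ => ?_
  rw [Nat.card_prod, Nat.cast_mul]
  exact congrArg₂ (· * ·) (G.coeff_csfSeries p.1.1).symm (H.coeff_csfSeries p.1.2).symm

/-- Two injective colorings with the same exponent vector differ by a weight-preserving permutation
of the vertices. -/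
theorem card_injective_exponent_eq (G : WeightedGraph.{u}) (hG : G.IsClique) {c₀ : G.V → ℕ+}
    (h₀ : Function.Injective c₀) :
    Nat.card {c : G.graph.Coloring ℕ+ // G.exponent c = G.exponent c₀} =
      IntPartition.multFactorial (Finset.univ.val.map G.weight) := by
  classical
  have hinj (c : G.graph.Coloring ℕ+) : Function.Injective c := fun v w h => by
    by_contra hne
    exact c.valid (hG v w hne) h
  have hcol (g : Equiv.Perm G.V) (hg : G.weight ∘ g = G.weight) :
      G.exponent (c₀ ∘ g) = G.exponent c₀ := by
    refine Eq.trans ?_ (Equiv.sum_comp g fun v => Finsupp.single (c₀ v) (G.weight v : ℕ))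
    refine Finset.sum_congr rfl fun v _ => ?_
    exact congrArg (fun n : ℕ+ => Finsupp.single (c₀ (g v)) (n : ℕ)) (congrFun hg v).symm
  -- Colorings are counted as `c₀ ∘ g`, with `g` in the stabilizer of the weight function.
  let F : {g : Equiv.Perm G.V // G.weight ∘ g = G.weight} →
      {c : G.graph.Coloring ℕ+ // G.exponent c = G.exponent c₀} := fun g =>
    ⟨SimpleGraph.Coloring.mk (c₀ ∘ g.1) fun {v w} h e =>
      h.ne (g.1.injective (h₀ e)), hcol g.1 g.2⟩
  have hF : Function.Bijective F := by
    refine ⟨fun g g' h => ?_, fun c => ?_⟩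
    · refine Subtype.ext (Equiv.ext fun v => h₀ ?_)
      exact DFunLike.congr_fun (congrArg Subtype.val h) v
    -- Equal exponent vectors have equal supports, so `c` and `c₀` use the same colors.
    · have hr (v : G.V) : ∃ w, c₀ w = c.1 v := by
        rw [← G.mem_support_exponent, ← congrArg Finsupp.support c.2]
        exact (G.mem_support_exponent _ _).2 ⟨v, rfl⟩
      choose g hg using hr
      have hgi : Function.Injective g := fun v w h => hinj c.1 (by rw [← hg, ← hg, h])
      refine ⟨⟨Equiv.ofBijective g (Finite.injective_iff_bijective.1 hgi), ?_⟩, ?_⟩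
      · funext v
        apply PNat.coe_injective
        have h1 := G.exponent_apply_of_injective h₀ (g v)
        rw [hg, ← DFunLike.congr_fun c.2 (c.1 v), G.exponent_apply_of_injective (hinj c.1)] at h1
        exact h1.symm
      · exact Subtype.ext (DFunLike.ext _ _ hg)
  -- The stabilizer permutes each weight class freely, so its order is the product of the factorials
  -- of the class sizes.
  rw [← Nat.card_eq_of_bijective F hF, Nat.card_eq_fintype_card, DomMulAct.stabilizer_card']
  unfold IntPartition.multFactorial
  refine Finset.prod_congr (by ext; simp) fun i _ => congrArg _ ?_
  rw [Multiset.count_map, Fintype.card_subtype, Finset.card_def, Finset.filter_val]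
  congr 1
  exact Multiset.filter_congr fun x _ => eq_comm

end WeightedGraph

/-! ### Augmented monomial functions as functions of cliques -/

theorem coeff_eq_of_hasShape (f : SymFun K) {d d' : ℕ+ →₀ ℕ} {lam : IntPartition}
    (h : HasShape d lam) (h' : HasShape d' lam) :
    MvPowerSeries.coeff d (f : MvPowerSeries ℕ+ K) =
      MvPowerSeries.coeff d' (f : MvPowerSeries ℕ+ K) := by
  obtain ⟨s, rfl⟩ := h.exists_perm h'
  exact (f.2.2 s d).symm

theorem coeff_augMonomial {d : ℕ+ →₀ ℕ} {lam : IntPartition} (mu : IntPartition)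
    (h : HasShape d lam) :
    MvPowerSeries.coeff d (augMonomial K mu : MvPowerSeries ℕ+ K) =
      if mu = lam then (mu.multFactorial : K) else 0 := by
  rw [augMonomial, Submodule.coe_smul, map_smul, coeff_monomialSym mu h, smul_eq_mul, mul_ite,
    mul_one, mul_zero]

/-- The augmented monomial symmetric functions are the chromatic symmetric functions of the weighted
cliques. -/
theorem WeightedGraph.csf_of_isClique (G : WeightedGraph.{u}) (hG : G.IsClique) :
    G.csf K = augMonomial K (Finset.univ.val.map G.weight) := by
  classical
  have hinj (c : G.graph.Coloring ℕ+) : Function.Injective c := fun v w h => by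
    by_contra hne
    exact c.valid (hG v w hne) h
  refine Subtype.ext (MvPowerSeries.ext fun d => ?_)
  obtain ⟨lam, hd⟩ := HasShape.exists_shape d
  rw [coeff_augMonomial _ hd]
  split_ifs with h
  · obtain ⟨c₀⟩ : Nonempty (G.V ↪ ℕ+) :=
      ⟨(Fintype.equivFin G.V).toEmbedding.trans
        (Fin.valEmbedding.trans ⟨Nat.succPNat, Nat.succPNat_injective⟩)⟩
    -- By symmetry `d` may be replaced by the exponent vector of an injective coloring.
    rw [coeff_eq_of_hasShape _ hd (h ▸ G.hasShape_exponent c₀.injective)]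
    refine (G.coeff_csfSeries _).trans ?_
    rw [G.card_injective_exponent_eq hG c₀.injective]
  · refine (G.coeff_csfSeries _).trans ?_
    have : IsEmpty {c : G.graph.Coloring ℕ+ // G.exponent c = d} :=
      ⟨fun c => h ((c.2 ▸ G.hasShape_exponent (hinj c.1) : HasShape d _).unique hd)⟩
    rw [Nat.card_of_isEmpty, Nat.cast_zero]

/-- The weighted clique whose vertex weights are the parts of `lam`. -/
noncomputable def cliqueOf (lam : IntPartition) : WeightedGraph.{0} where
  V := lam.ToType
  graph := ⊤
  weight v := v.1

theorem csf_cliqueOf (lam : IntPartition) : (cliqueOf lam).csf K = augMonomial K lam := by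
  rw [WeightedGraph.csf_of_isClique _ fun v w h => (SimpleGraph.top_adj v w).2 h]
  exact congrArg (augMonomial K) (Multiset.map_univ_coe lam)

theorem csf_cliqueOf_join (lam mu : IntPartition) :
    ((cliqueOf lam).join (cliqueOf mu)).csf K = augMonomial K (lam + mu) := by
  rw [WeightedGraph.csf_of_isClique]
  · congr 1
    refine Eq.trans ?_ (congrArg₂ (· + ·) (Multiset.map_univ_coe lam) (Multiset.map_univ_coe mu))
    refine (congrArg (Multiset.map _) (Finset.val_disjSum _ _)).trans ?_
    refine (Multiset.map_add _ _ _).trans ?_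
    exact congrArg₂ (· + ·) (Multiset.map_map _ _ _) (Multiset.map_map _ _ _)
  · rintro (v | v) (w | w) h
    · exact Or.inl (fun e => h (congrArg _ e))
    · exact Or.inr (Or.inl ⟨rfl, rfl⟩)
    · exact Or.inr (Or.inr ⟨rfl, rfl⟩)
    · exact Or.inl (fun e => h (congrArg _ e))

/-! ### Tsujie's product and joins -/

section

variable [CharZero K]

/-- Tsujie's product in terms of coefficients: the sum over all ways to split the variables. -/
theorem coeff_odot (f g : SymFun K) (d : ℕ+ →₀ ℕ) :
    MvPowerSeries.coeff d (odot K f g : MvPowerSeries ℕ+ K) =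
      ∑ p ∈ (Finset.HasAntidiagonal.antidiagonal d).filter fun p => Disjoint p.1.support p.2.support,
        MvPowerSeries.coeff p.1 (f : MvPowerSeries ℕ+ K) *
          MvPowerSeries.coeff p.2 (g : MvPowerSeries ℕ+ K) := by
  induction f using augMonomial_induction with
  | hm lam =>
    induction g using augMonomial_induction with
    | hm mu =>
      rw [odot_augMonomial, ← csf_cliqueOf_join, WeightedGraph.coeff_csf_join, csf_cliqueOf,
        csf_cliqueOf]
    | h0 => simp
    | hadd f g hf hg => simp [hf, hg, mul_add, Finset.sum_add_distrib]
    | hsmul c f hf => simp [hf, Finset.mul_sum, mul_left_comm]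
  | h0 => simp
  | hadd f g hf hg => simp [hf, hg, add_mul, Finset.sum_add_distrib]
  | hsmul c f hf => simp [hf, Finset.mul_sum, mul_assoc]

theorem WeightedGraph.csf_join (G H : WeightedGraph.{u}) :
    (G.join H).csf K = odot K (G.csf K) (H.csf K) :=
  Subtype.ext (MvPowerSeries.ext fun d => by rw [coeff_csf_join, coeff_odot])

end

/-! ### Complements, homogeneity and one-color colorings -/

namespace WeightedGraph

theorem compl_disjUnion (G H : WeightedGraph.{u}) :
    (G.disjUnion H).compl = G.compl.join H.compl := by
  have h : (G.graph.sum H.graph)ᶜ =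
      G.graphᶜ.sum H.graphᶜ ⊔ completeBipartiteGraph G.V H.V := by
    ext v w
    rcases v with v | v <;> rcases w with w | w <;> simp [SimpleGraph.compl_adj]
  unfold disjUnion compl join
  rw [h]

theorem compl_empty : empty.{u}.compl = empty := by
  have h : (⊥ : SimpleGraph PEmpty.{u + 1})ᶜ = ⊥ := by
    ext v
    exact v.elim
  unfold empty compl
  rw [h]

theorem compl_disjUnionList (L : List WeightedGraph.{u}) :
    (disjUnionList L).compl = joinList (L.map compl) := by
  induction L with
  | nil => exact compl_empty
  | cons G L ih =>
    refine (compl_disjUnion _ _).trans ?_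
    exact congrArg (join G.compl) ih

theorem csf_empty : empty.{u}.csf K = augMonomial K 0 :=
  csf_of_isClique _ fun v => v.elim

theorem coeff_csf_eq_zero (G : WeightedGraph.{u}) {d : ℕ+ →₀ ℕ} (h : d.degree ≠ G.totalWeight) :
    MvPowerSeries.coeff d (G.csf K : MvPowerSeries ℕ+ K) = 0 := by
  have : IsEmpty {c : G.graph.Coloring ℕ+ // G.exponent c = d} :=
    ⟨fun c => h (by rw [← c.2, G.degree_exponent])⟩
  refine (G.coeff_csfSeries d).trans ?_
  rw [Nat.card_of_isEmpty, Nat.cast_zero]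

theorem isHomogeneous_csf (G : WeightedGraph.{u}) :
    MvPowerSeries.IsHomogeneous (G.csf K : MvPowerSeries ℕ+ K) G.totalWeight := by
  intro d hd
  by_contra h
  refine hd (G.coeff_csf_eq_zero ?_)
  rwa [Finsupp.degree_eq_weight_one]

theorem totalWeight_disjUnion (G H : WeightedGraph.{u}) :
    (G.disjUnion H).totalWeight = G.totalWeight + H.totalWeight :=
  Fintype.sum_sum_type _

theorem totalWeight_disjUnionList (L : List WeightedGraph.{u}) :
    (disjUnionList L).totalWeight =
      (L.map totalWeight).sum := by
  induction L with
  | nil => rfl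
  | cons G L ih =>
    rw [List.map_cons, List.sum_cons, ← ih]
    exact totalWeight_disjUnion _ _

theorem eq_of_exponent_eq_single (G : WeightedGraph.{u}) {c : G.V → ℕ+} {i : ℕ+} {k : ℕ}
    (h : G.exponent c = Finsupp.single i k) (v : G.V) : c v = i := by
  have hv := (G.mem_support_exponent c (c v)).2 ⟨v, rfl⟩
  rw [h] at hv
  exact Finset.mem_singleton.1 (Finsupp.support_single_subset hv)

/-- A coloring with the single color `i` is proper only if the complement has no edges. -/
theorem coeff_single_csf_compl_ne_zero (G : WeightedGraph.{u}) {i : ℕ+} {k : ℕ}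
    (h : MvPowerSeries.coeff (Finsupp.single i k) (G.compl.csf K : MvPowerSeries ℕ+ K) ≠ 0) :
    G.IsClique ∧ G.totalWeight = k := by
  have hne : Nonempty {c : G.compl.graph.Coloring ℕ+ //
      G.compl.exponent c = Finsupp.single i k} := by
    by_contra hemp
    rw [not_nonempty_iff] at hemp
    refine h ((G.compl.coeff_csfSeries _).trans ?_)
    rw [Nat.card_of_isEmpty, Nat.cast_zero]
  obtain ⟨c, hc⟩ := hne
  constructor
  · intro v w hvw
    by_contra hadj
    have hc' := G.compl.eq_of_exponent_eq_single hc
    exact c.valid ((SimpleGraph.compl_adj _ _ _).2 ⟨hvw, hadj⟩) ((hc' v).trans (hc' w).symm)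
  · have := G.compl.degree_exponent c
    rw [hc, Finsupp.degree_single] at this
    exact this.symm

theorem coeff_single_csf_compl_of_isClique (G : WeightedGraph.{u}) (hG : G.IsClique) (i : ℕ+) :
    MvPowerSeries.coeff (Finsupp.single i G.totalWeight)
      (G.compl.csf K : MvPowerSeries ℕ+ K) = 1 := by
  let c₀ : G.compl.graph.Coloring ℕ+ := SimpleGraph.Coloring.mk (fun _ => i) fun {v w} h =>
    absurd (hG v w ((SimpleGraph.compl_adj _ _ _).1 h).1) ((SimpleGraph.compl_adj _ _ _).1 h).2
  have h₀ : G.compl.exponent c₀ = Finsupp.single i G.totalWeight := by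
    rw [totalWeight, Finsupp.single_finsetSum]
    rfl
  let _ : Unique {c : G.compl.graph.Coloring ℕ+ //
      G.compl.exponent c = Finsupp.single i G.totalWeight} :=
    ⟨⟨⟨c₀, h₀⟩⟩, fun c => Subtype.ext (DFunLike.ext _ _
      (G.compl.eq_of_exponent_eq_single c.2))⟩
  refine (G.compl.coeff_csfSeries _).trans ?_
  rw [Nat.card_unique, Nat.cast_one]

end WeightedGraph

theorem unionAlong_compl (G : ℕ+ → WeightedGraph.{u}) (lam : IntPartition) :
    (unionAlong G lam).compl = joinComplAlong G lam := by
  refine (WeightedGraph.compl_disjUnionList _).trans ?_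
  rw [List.map_map]
  rfl

theorem hasShape_single (i k : ℕ+) : HasShape (Finsupp.single i (k : ℕ)) {k} := by
  rw [HasShape, Finsupp.support_single i k.ne_zero]
  simp

theorem multFactorial_singleton (k : ℕ+) : IntPartition.multFactorial {k} = 1 := by
  simp [IntPartition.multFactorial]

theorem size_add (lam mu : IntPartition) :
    IntPartition.size (lam + mu) = lam.size + mu.size := by
  simp [IntPartition.size]

theorem size_zero : IntPartition.size 0 = 0 := rfl

theorem size_singleton (k : ℕ+) : IntPartition.size {k} = k := by simp [IntPartition.size]

theorem card_le_size (lam : IntPartition) : Multiset.card lam ≤ lam.size := by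
  induction lam using Multiset.induction_on with
  | empty => exact le_rfl
  | cons a s ih =>
    rw [← Multiset.singleton_add, size_add, size_singleton, Multiset.card_add,
      Multiset.card_singleton]
    exact Nat.add_le_add a.pos ih

/-! ### Coordinates in Tsujie's ring and multiplicativity of the family -/

variable [CharZero K]

/-- The augmented monomial symmetric functions as a basis of Tsujie's ring. -/
noncomputable def tsujieBasis (K : Type v) [Field K] [CharZero K] :
    Module.Basis IntPartition K (TsujieRing K) :=
  (augBasis K).map toTsujie

theorem tsujieBasis_apply (lam : IntPartition) :
    tsujieBasis K lam = toTsujie (augMonomial K lam) := by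
  rw [tsujieBasis, Module.Basis.map_apply, augBasis_apply]

theorem tsujieBasis_add (lam mu : IntPartition) :
    tsujieBasis K (lam + mu) = tsujieBasis K lam * tsujieBasis K mu := by
  simp only [tsujieBasis_apply, toTsujie_augMonomial_mul]

theorem tsujieBasis_zero : tsujieBasis K 0 = 1 := tsujieBasis_apply 0

/-- Translates between power series coefficients and coordinates in the augmented basis. -/
theorem multFactorial_mul_repr {d : ℕ+ →₀ ℕ} {lam : IntPartition} (h : HasShape d lam)
    (f : SymFun K) :
    (lam.multFactorial : K) * (tsujieBasis K).repr (toTsujie f) lam =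
      MvPowerSeries.coeff d (f : MvPowerSeries ℕ+ K) := by
  induction f using augMonomial_induction with
  | hm mu =>
    rw [← tsujieBasis_apply, Module.Basis.repr_self, Finsupp.single_apply,
      coeff_augMonomial mu h]
    split_ifs with e <;> simp [e]
  | h0 => simp
  | hadd f g hf hg => simp [← hf, ← hg, mul_add]
  | hsmul c f hf => simp [← hf, mul_left_comm]

theorem multFactorial_ne_zero (lam : IntPartition) : (lam.multFactorial : K) ≠ 0 :=
  Nat.cast_ne_zero.2 (Finset.prod_ne_zero_iff.2 fun _ _ => Nat.factorial_ne_zero _)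

theorem toTsujie_csf_join (G H : WeightedGraph.{u}) :
    toTsujie ((G.join H).csf K) = toTsujie (G.csf K) * toTsujie (H.csf K) :=
  congrArg toTsujie (G.csf_join H)

theorem toTsujie_csf_joinList (L : List WeightedGraph.{u}) :
    toTsujie ((WeightedGraph.joinList L).csf K) = (L.map fun G => toTsujie (G.csf K)).prod := by
  induction L with
  | nil => exact congrArg toTsujie WeightedGraph.csf_empty
  | cons G L ih =>
    rw [List.map_cons, List.prod_cons, ← ih]
    exact toTsujie_csf_join _ _

theorem cochromaticFamily_eq_prod (G : ℕ+ → WeightedGraph.{u}) (lam : IntPartition) :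
    cochromaticFamily K G lam = (lam.map fun n => toTsujie ((G n).compl.csf K)).prod := by
  rw [cochromaticFamily, unionAlong_compl, joinComplAlong, toTsujie_csf_joinList, List.map_map,
    ← Multiset.prod_coe, ← Multiset.map_coe, IntPartition.parts, Multiset.sort_eq]
  rfl

theorem cochromaticFamily_add (G : ℕ+ → WeightedGraph.{u}) (lam mu : IntPartition) :
    cochromaticFamily K G (lam + mu) = cochromaticFamily K G lam * cochromaticFamily K G mu := by
  simp only [cochromaticFamily_eq_prod, Multiset.map_add, Multiset.prod_add]

theorem cochromaticFamily_zero (G : ℕ+ → WeightedGraph.{u}) : cochromaticFamily K G 0 = 1 := by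
  rw [cochromaticFamily_eq_prod, Multiset.map_zero, Multiset.prod_zero]

theorem cochromaticFamily_singleton (G : ℕ+ → WeightedGraph.{u}) (n : ℕ+) :
    cochromaticFamily K G {n} = toTsujie ((G n).compl.csf K) := by
  rw [cochromaticFamily_eq_prod, Multiset.map_singleton, Multiset.prod_singleton]

theorem cochromaticFamily_comp (G : ℕ+ → WeightedGraph.{u}) (s : ℕ+ → ℕ+) :
    cochromaticFamily K (G ∘ s) = cochromaticFamily K G ∘ Multiset.map s := by
  funext lam
  simp only [cochromaticFamily_eq_prod, Function.comp_apply, Multiset.map_map]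

/-! ### The filtration by number of parts -/

/-- The span of the augmented monomial functions of degree `N` with at least `r` parts. -/
noncomputable def partSpan (K : Type v) [Field K] [CharZero K] (N r : ℕ) :
    Submodule K (TsujieRing K) :=
  Submodule.span K (tsujieBasis K '' {lam | lam.size = N ∧ r ≤ Multiset.card lam})

theorem mem_partSpan {N r : ℕ} {f : TsujieRing K} :
    f ∈ partSpan K N r ↔ ∀ lam, (tsujieBasis K).repr f lam ≠ 0 →
      lam.size = N ∧ r ≤ Multiset.card lam := by
  rw [partSpan, Module.Basis.mem_span_image]
  exact forall_congr' fun lam => by rw [Finset.mem_coe, Finsupp.mem_support_iff]; rfl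

theorem tsujieBasis_mem_partSpan (lam : IntPartition) :
    tsujieBasis K lam ∈ partSpan K lam.size (Multiset.card lam) :=
  Submodule.subset_span ⟨lam, ⟨rfl, le_rfl⟩, rfl⟩

theorem partSpan_anti (N : ℕ) {r s : ℕ} (h : r ≤ s) : partSpan K N s ≤ partSpan K N r :=
  Submodule.span_mono (Set.image_mono fun _ hl => ⟨hl.1, h.trans hl.2⟩)

theorem mul_mem_partSpan {N M r s : ℕ} {f g : TsujieRing K} (hf : f ∈ partSpan K N r)
    (hg : g ∈ partSpan K M s) : f * g ∈ partSpan K (N + M) (r + s) := by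
  have h : partSpan K N r * partSpan K M s ≤ partSpan K (N + M) (r + s) := by
    rw [partSpan, partSpan, Submodule.span_mul_span, Submodule.span_le]
    rintro _ ⟨_, ⟨lam, hl, rfl⟩, _, ⟨mu, hm, rfl⟩, rfl⟩
    refine Submodule.subset_span ⟨lam + mu, ⟨?_, ?_⟩, tsujieBasis_add lam mu⟩
    · rw [size_add, hl.1, hm.1]
    · rw [Multiset.card_add]
      exact Nat.add_le_add hl.2 hm.2
  exact h (Submodule.mul_mem_mul hf hg)

theorem csf_mem_partSpan (G : WeightedGraph.{u}) : toTsujie (G.csf K) ∈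
    partSpan K G.totalWeight 0 := by
  refine mem_partSpan.2 fun lam h => ⟨?_, Nat.zero_le _⟩
  obtain ⟨d, hd⟩ := HasShape.exists_vec lam
  rw [← hd.degree_eq]
  by_contra hdeg
  refine mul_ne_zero (multFactorial_ne_zero lam) h ?_
  rw [multFactorial_mul_repr hd, G.coeff_csf_eq_zero hdeg]

/-- Only the empty partition has no parts, and its size is `0`. -/
theorem csf_mem_partSpan_one (G : WeightedGraph.{u}) (hG : G.totalWeight ≠ 0) :
    toTsujie (G.csf K) ∈ partSpan K G.totalWeight 1 := by
  refine mem_partSpan.2 fun lam h => ?_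
  have h1 := (mem_partSpan.1 (csf_mem_partSpan G) lam h).1
  refine ⟨h1, Multiset.card_pos.2 ?_⟩
  rintro rfl
  exact hG (h1.symm.trans size_zero)

theorem repr_csf_singleton (G : WeightedGraph.{u}) (k : ℕ+) :
    (tsujieBasis K).repr (toTsujie (G.csf K)) {k} =
      MvPowerSeries.coeff (Finsupp.single 1 (k : ℕ)) (G.csf K : MvPowerSeries ℕ+ K) := by
  rw [← multFactorial_mul_repr (hasShape_single 1 k), multFactorial_singleton, Nat.cast_one,
    one_mul]

/-- For a clique of weight `n`, the leading term is the augmented monomial function of `n`. -/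
theorem csf_compl_sub_mem_partSpan (G : WeightedGraph.{u}) (hG : G.IsClique) {n : ℕ+}
    (hn : G.totalWeight = n) :
    toTsujie (G.compl.csf K) - tsujieBasis K {n} ∈ partSpan K n 2 := by
  have h1 : toTsujie (G.compl.csf K) - tsujieBasis K {n} ∈ partSpan K n 1 := by
    refine sub_mem ?_ ?_
    · have := csf_mem_partSpan_one (K := K) G.compl
        (show G.totalWeight ≠ 0 by rw [hn]; exact n.ne_zero)
      rwa [show G.compl.totalWeight = n from hn] at this
    · simpa [size_singleton] using tsujieBasis_mem_partSpan (K := K) {n}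
  refine mem_partSpan.2 fun lam h => ?_
  obtain ⟨hs, hc⟩ := mem_partSpan.1 h1 lam h
  refine ⟨hs, ?_⟩
  by_contra hlt
  obtain ⟨m, rfl⟩ := Multiset.card_eq_one.1 (show Multiset.card lam = 1 by omega)
  obtain rfl : m = n := PNat.coe_injective ((size_singleton m).symm.trans hs)
  refine h ?_
  -- The only one-part partition of size `n` is `{n}`, where both terms have coordinate `1`.
  rw [map_sub, Finsupp.sub_apply, Module.Basis.repr_self, Finsupp.single_eq_same,
    repr_csf_singleton, ← hn, G.coeff_single_csf_compl_of_isClique hG, sub_self]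

/-- Splitting off one part uses `xy - ab = (x - a)y + a(y - b)`: each summand has a factor with one
part more than its leading term. -/
theorem cochromaticFamily_sub_mem_partSpan (G : ℕ+ → WeightedGraph.{u})
    (hG : ∀ n, (G n).IsClique ∧ (G n).totalWeight = n) (lam : IntPartition) :
    cochromaticFamily K G lam - tsujieBasis K lam ∈
      partSpan K (IntPartition.size lam) (Multiset.card lam + 1) := by
  induction lam using Multiset.induction_on with
  | empty => rw [cochromaticFamily_zero, tsujieBasis_zero, sub_self]; exact zero_mem _
  | cons n lam ih =>
    rw [← Multiset.singleton_add, cochromaticFamily_add, tsujieBasis_add, size_add,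
      size_singleton, cochromaticFamily_singleton, Multiset.card_add, Multiset.card_singleton]
    have h1 := csf_compl_sub_mem_partSpan (K := K) (G n) (hG n).1 (hG n).2
    have h2 : cochromaticFamily K G lam ∈
        partSpan K (IntPartition.size lam) (Multiset.card lam) := by
      rw [← sub_add_cancel (cochromaticFamily K G lam) (tsujieBasis K lam)]
      exact add_mem (partSpan_anti _ (Nat.le_succ _) ih) (tsujieBasis_mem_partSpan lam)
    have h3 : tsujieBasis K {n} ∈ partSpan K n 1 := by
      simpa [size_singleton] using tsujieBasis_mem_partSpan (K := K) {n}
    have h4 := add_mem (mul_mem_partSpan h1 h2)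
      (partSpan_anti _ (show 2 + Multiset.card lam ≤ 1 + (Multiset.card lam + 1) by omega)
        (mul_mem_partSpan h3 ih))
    rw [show 1 + Multiset.card lam + 1 = 2 + Multiset.card lam by omega]
    convert h4 using 1
    ring

/-! ### Unitriangular families are bases -/

section Unitriangular

variable {b : IntPartition → TsujieRing K}
  (hb : ∀ lam, b lam - tsujieBasis K lam ∈
    partSpan K (IntPartition.size lam) (Multiset.card lam + 1))

include hb

theorem span_eq_top_of_unitriangular : Submodule.span K (Set.range b) = ⊤ := by
  -- The correction terms have the same size and more parts, so this difference drops;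
  -- `card_le_size` rules out truncation.
  have key (k : ℕ) : ∀ lam : IntPartition, lam.size - Multiset.card lam = k →
      tsujieBasis K lam ∈ Submodule.span K (Set.range b) := by
    induction k using Nat.strong_induction_on with
    | _ k ih =>
      intro lam hk
      have hle : partSpan K lam.size (Multiset.card lam + 1) ≤ Submodule.span K (Set.range b) := by
        rw [partSpan, Submodule.span_le]
        rintro _ ⟨mu, ⟨hs, hc⟩, rfl⟩
        have := card_le_size mu
        exact ih (mu.size - Multiset.card mu) (by omega) mu rfl
      rw [← sub_sub_cancel (b lam) (tsujieBasis K lam)]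
      exact sub_mem (Submodule.subset_span ⟨lam, rfl⟩) (hle (hb lam))
  rw [eq_top_iff, ← (tsujieBasis K).span_eq, Submodule.span_le]
  rintro _ ⟨lam, rfl⟩
  exact key _ lam rfl

theorem linearIndependent_of_unitriangular : LinearIndependent K b := by
  rw [linearIndependent_iff]
  intro c hc
  by_contra hne
  -- For `lam` with the fewest parts, no correction term of another member of the support reaches
  -- `lam`.
  obtain ⟨lam, hl, hmin⟩ := Finset.exists_min_image c.support Multiset.card
    (Finsupp.support_nonempty_iff.2 hne)
  have hrep (mu : IntPartition) (hmu : mu ∈ c.support) :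
      (tsujieBasis K).repr (b mu) lam = if mu = lam then 1 else 0 := by
    have h0 : (tsujieBasis K).repr (b mu - tsujieBasis K mu) lam = 0 := by
      by_contra h
      have := (mem_partSpan.1 (hb mu) lam h).2
      have := hmin mu hmu
      omega
    rw [map_sub, Finsupp.sub_apply, sub_eq_zero] at h0
    rw [h0, Module.Basis.repr_self, Finsupp.single_apply]
  have h := DFunLike.congr_fun (congrArg (tsujieBasis K).repr hc) lam
  rw [Finsupp.linearCombination_apply, Finsupp.sum, map_sum, Finsupp.finsetSum_apply,
    Finset.sum_congr rfl fun mu hmu => by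
      rw [map_smul, Finsupp.smul_apply, hrep mu hmu, smul_eq_mul, mul_ite, mul_one, mul_zero],
    Finset.sum_ite_eq' c.support lam, if_pos hl, map_zero] at h
  exact Finsupp.mem_support_iff.1 hl h

end Unitriangular

/-! ### Cliques of every weight give a basis -/

theorem isMultiplicativeBasis_of_isClique (G : ℕ+ → WeightedGraph.{u})
    (hG : ∀ n, (G n).IsClique ∧ (G n).totalWeight = n) :
    IsMultiplicativeBasis (cochromaticFamily K G) :=
  have h := cochromaticFamily_sub_mem_partSpan G hG
  ⟨linearIndependent_of_unitriangular h, span_eq_top_of_unitriangular h, cochromaticFamily_add G⟩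

theorem isMultiplicativeBasis_comp_perm (G : ℕ+ → WeightedGraph.{u}) (s : Equiv.Perm ℕ+)
    (h : IsMultiplicativeBasis (cochromaticFamily K (G ∘ s))) :
    IsMultiplicativeBasis (cochromaticFamily K G) := by
  let e : IntPartition ≃ IntPartition :=
    ⟨Multiset.map s, Multiset.map s.symm, fun lam => by simp, fun lam => by simp⟩
  have he : cochromaticFamily K (G ∘ s) = cochromaticFamily K G ∘ e := cochromaticFamily_comp G s
  refine ⟨?_, ?_, cochromaticFamily_add G⟩
  · have := h.linearIndependent
    rw [he] at this
    exact (linearIndependent_equiv e).1 this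
  · have := h.span_eq_top
    rwa [he, e.surjective.range_comp] at this

/-! ### A basis forces cliques of every weight -/

/-- A graph of weight `0` has no vertices, so its function is `1`, which is already the member at
the empty partition. -/
theorem totalWeight_ne_zero_of_linearIndependent {G : ℕ+ → WeightedGraph.{u}}
    (h : LinearIndependent K (cochromaticFamily K G)) (n : ℕ+) : (G n).totalWeight ≠ 0 := by
  intro h0
  have : IsEmpty (G n).V := ⟨fun v =>
    ((G n).weight v).ne_zero (Finset.sum_eq_zero_iff.1 h0 v (Finset.mem_univ v))⟩
  have hc : toTsujie ((G n).compl.csf K) = 1 := by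
    rw [WeightedGraph.csf_of_isClique (G n).compl fun v => (this.false v).elim]
    have hu : (Finset.univ : Finset (G n).compl.V) = ∅ :=
      Finset.eq_empty_of_forall_notMem fun v => (this.false v).elim
    rw [hu]
    exact tsujieBasis_apply (K := K) 0 ▸ tsujieBasis_zero
  have h1 : cochromaticFamily K G {n} = cochromaticFamily K G 0 := by
    rw [cochromaticFamily_singleton, hc, cochromaticFamily_zero]
  exact Multiset.singleton_ne_zero n (h.injective h1)

theorem cochromaticFamily_mem_partSpan {G : ℕ+ → WeightedGraph.{u}}
    (hG : ∀ n, (G n).totalWeight ≠ 0) (lam : IntPartition) :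
    ∃ N, cochromaticFamily K G lam ∈ partSpan K N (Multiset.card lam) := by
  induction lam using Multiset.induction_on with
  | empty =>
    refine ⟨0, ?_⟩
    rw [cochromaticFamily_zero, ← tsujieBasis_zero]
    exact tsujieBasis_mem_partSpan 0
  | cons n lam ih =>
    obtain ⟨N, hN⟩ := ih
    refine ⟨(G n).totalWeight + N, ?_⟩
    rw [← Multiset.singleton_add, cochromaticFamily_add, cochromaticFamily_singleton,
      Multiset.card_add, Multiset.card_singleton]
    exact mul_mem_partSpan (csf_mem_partSpan_one (G n).compl (hG n)) hN

/-- Modulo decomposable elements only the cliques contribute, so a basis must contain a clique of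
every weight. -/
theorem exists_isClique_of_isMultiplicativeBasis {G : ℕ+ → WeightedGraph.{u}}
    (h : IsMultiplicativeBasis (cochromaticFamily K G)) (k : ℕ+) :
    ∃ n, (G n).IsClique ∧ (G n).totalWeight = k := by
  by_contra! hno
  have hG := totalWeight_ne_zero_of_linearIndependent h.linearIndependent
  have hzero : (tsujieBasis K).coord {k} = 0 := by
    refine LinearMap.ext_on h.span_eq_top ?_
    rintro _ ⟨lam, rfl⟩
    rw [Module.Basis.coord_apply, LinearMap.zero_apply]
    by_contra hne
    obtain ⟨N, hN⟩ := cochromaticFamily_mem_partSpan (K := K) hG lam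
    have hc := (mem_partSpan.1 hN _ hne).2
    rw [Multiset.card_singleton] at hc
    -- Members with two or more factors involve only partitions with two or more parts and miss
    -- `{k}`.
    rcases Nat.le_one_iff_eq_zero_or_eq_one.1 hc with h0 | h1
    · rw [Multiset.card_eq_zero.1 h0, cochromaticFamily_zero, ← tsujieBasis_zero,
        Module.Basis.repr_self, Finsupp.single_apply] at hne
      exact hne (if_neg (Multiset.singleton_ne_zero k).symm)
    · obtain ⟨n, rfl⟩ := Multiset.card_eq_one.1 h1
      rw [cochromaticFamily_singleton, repr_csf_singleton] at hne
      obtain ⟨hcl, hw⟩ := (G n).coeff_single_csf_compl_ne_zero hne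
      exact hno n hcl hw
  have h1 := LinearMap.congr_fun hzero (tsujieBasis K {k})
  rw [Module.Basis.coord_apply, Module.Basis.repr_self, Finsupp.single_eq_same] at h1
  exact one_ne_zero h1

theorem exists_perm_of_isMultiplicativeBasis {G : ℕ+ → WeightedGraph.{u}}
    (h : IsMultiplicativeBasis (cochromaticFamily K G)) :
    ∃ s : Equiv.Perm ℕ+, ∀ n : ℕ+, (G (s n)).IsClique ∧ (G (s n)).totalWeight = n := by
  choose t ht using exists_isClique_of_isMultiplicativeBasis h
  have hinj : Function.Injective t := fun k l hkl =>
    PNat.coe_injective (by rw [← (ht k).2, ← (ht l).2, hkl])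
  have hspan := (isMultiplicativeBasis_of_isClique (K := K) (G ∘ t) ht).span_eq_top
  have hsurj : Function.Surjective t := by
    intro n
    by_contra hn
    -- The members whose parts are values of `t` already span, so the member at `{n}` with `n`
    -- missed by `t` would depend on them.
    refine h.linearIndependent.notMem_span_image (s := Set.range (Multiset.map t)) (x := {n})
      ?_ ?_
    · rintro ⟨lam, hl⟩
      obtain ⟨k, -, hk⟩ := Multiset.mem_map.1 (hl ▸ Multiset.mem_singleton_self n)
      exact hn ⟨k, hk⟩
    · rw [← Set.range_comp, ← cochromaticFamily_comp, hspan]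
      exact Submodule.mem_top
  exact ⟨Equiv.ofBijective t ⟨hinj, hsurj⟩, ht⟩

/-! ### Gradedness -/

theorem totalWeight_unionAlong (G : ℕ+ → WeightedGraph.{u}) (lam : IntPartition) :
    (unionAlong G lam).totalWeight = (lam.map fun n => (G n).totalWeight).sum := by
  rw [unionAlong, WeightedGraph.totalWeight_disjUnionList, List.map_map, ← Multiset.sum_coe,
    ← Multiset.map_coe, IntPartition.parts, Multiset.sort_eq]
  rfl

theorem isGradedFamily_of_totalWeight {G : ℕ+ → WeightedGraph.{u}}
    (hG : ∀ n, (G n).totalWeight = n) : IsGradedFamily (cochromaticFamily K G) := by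
  intro lam
  have h : (unionAlong G lam).compl.totalWeight = lam.size := by
    refine (totalWeight_unionAlong G lam).trans ?_
    rw [IntPartition.size]
    exact congrArg Multiset.sum (Multiset.map_congr rfl fun n _ => hG n)
  rw [← h]
  exact @WeightedGraph.isHomogeneous_csf K _ _

theorem totalWeight_eq_of_isGradedFamily {G : ℕ+ → WeightedGraph.{u}}
    (h : IsGradedFamily (cochromaticFamily K G)) {n : ℕ+} (hn : (G n).IsClique) :
    (G n).totalWeight = n := by
  have h1 : MvPowerSeries.IsHomogeneous
      (toTsujie.symm (cochromaticFamily K G {n}) : MvPowerSeries ℕ+ K) (IntPartition.size {n}) :=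
    h {n}
  rw [cochromaticFamily_singleton, size_singleton] at h1
  by_contra hne
  -- This coefficient is `1` for a clique, so its degree must be `n`.
  have h0 := h1.coeff_eq_zero (d := Finsupp.single 1 (G n).totalWeight)
    (by rwa [Finsupp.degree_single])
  exact one_ne_zero (((G n).coeff_single_csf_compl_of_isClique hn 1).symm.trans h0)

end Cochromatic

theorem proposition1p1 (K : Type v) [Field K] [CharZero K]
    (G : ℕ+ → Cochromatic.WeightedGraph.{u}) :
    (∀ lam : Cochromatic.IntPartition,
      (Cochromatic.unionAlong G lam).compl.csf K = (Cochromatic.joinComplAlong G lam).csf K) ∧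
    (Cochromatic.IsMultiplicativeBasis (Cochromatic.cochromaticFamily K G) ↔
      ∃ s : Equiv.Perm ℕ+, ∀ n : ℕ+, (G (s n)).IsClique ∧ (G (s n)).totalWeight = n) ∧
    (Cochromatic.IsMultiplicativeBasis (Cochromatic.cochromaticFamily K G) ∧
        Cochromatic.IsGradedFamily (Cochromatic.cochromaticFamily K G) ↔
      ∀ n : ℕ+, (G n).IsClique ∧ (G n).totalWeight = n) := by
  open Cochromatic in
  refine ⟨fun lam => by rw [unionAlong_compl],
    ⟨exists_perm_of_isMultiplicativeBasis, fun ⟨s, hs⟩ =>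
      isMultiplicativeBasis_comp_perm G s (isMultiplicativeBasis_of_isClique (G ∘ s) hs)⟩,
    ⟨fun ⟨hb, hg⟩ n => ?_, fun hG =>
      ⟨isMultiplicativeBasis_of_isClique G hG, isGradedFamily_of_totalWeight fun n => (hG n).2⟩⟩⟩
  -- The permutation shows only that every `G n` is a clique; the grading supplies its weight.
  obtain ⟨s, hs⟩ := exists_perm_of_isMultiplicativeBasis hb
  have hn : (G n).IsClique := by simpa using (hs (s.symm n)).1
  exact ⟨hn, totalWeight_eq_of_isGradedFamily hg hn⟩
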